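/- **Setting.** Let $V=\{1,\dots,p\}$ and let $F:2^V\to\mathbb R$ be submodular, i.e. $F(A)+F(B)\ge F(A\cup B)+F(A\cap B)$ for all $A,B\subset V$, with $F(\varnothing)=F(V)=0$ and $F(A)>0$ for every $A\ne\varnothing,V$. Let $f(w)=\int_{\mathbb R}F(\{k: w_k\ge\alpha\})\,d\alpha$, $w\in\mathbb R^p$, be its Lovász extension. A *lattice* is a family $\mathcal D\subset 2^V$ that contains $\varnothing$ and $V$ and is closed under union and intersection. Its *poset* $\Pi(\mathcal D)$ consists of the differences $T\setminus S$ of consecutive sets in maximal chains of $\mathcal D$; these blocks form a partition of $V$. It is ordered by: $A\succcurlyeq A'$ if every member of $\mathcal D$ that contains $A'$ also contains $A$. Let $\mathcal U^\circ_{\mathcal D}$ be the set of $w\in\mathbb R^p$ that are constant on every block and such that the value of $w$ on $A$ is strictly larger than its value on $A'$ whenever $A\succcurlyeq A'$ and $A\neq A'$. A set $A$ is *separable* for $G:2^V\to\mathbb R$ if $A$ is the disjoint union of two nonempty sets $B,C$ with $G(A)=G(B)+G(C)$, and *inseparable* otherwise. We say that $\mathcal D$ is *associated to* $w$ if $w\in\mathcal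 U^\circ_{\mathcal D}$ and 1. $F(A)+F(B)=F(A\cup B)+F(A\cap B)$ for all $A,B\in\mathcal D$; 2. every block $A$ is inseparable for $C\mapsto F(B\cup C)-F(B)$, where $B$ is the union of all blocks $A'\ne A$ with $A'\succcurlyeq A$; 3. $\mathcal D$ is maximal for inclusion among the lattices that satisfy 1 and 2 and have the same unordered partition into blocks. **Theorem (level set recovery).** Let $\lambda\ge 0$, $\sigma>0$, and $z=w^\ast+\sigma\varepsilon$, where $w^\ast\in\mathbb R^p$ and $\varepsilon\in\mathbb R^p$ is a standard Gaussian random vector. Let $\mathcal D$ be the lattice associated to $w^\ast$, let $A_1,\dots,A_m$ be the blocks of $\Pi(\mathcal D)$, numbered so that $A_i\succcurlyeq A_j$ implies $i\le j$, let $v^\ast_j$ be the value of $w^\ast$ on $A_j$, and let $B_j=A_1\cup\dots\cup A_j$ (so $B_0=\varnothing$). Assume that there are constants $\eta_1,\dots,\eta_m>0$ and $\nu>0$ such that - for all $j$ and all $C\subset A_j$, $$F(B_{j-1}\cup C)-F(B_{j-1})-\tfrac{|C|}{|A_j|}\big[F(B_{j-1}\cup A_j)-F(B_{j-1})\big]\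 \ge\ \eta_j\min\Big\{\tfrac{|C|}{|A_j|},\,1-\tfrac{|C|}{|A_j|}\Big\};$$ - for all $i\ne j$, if $A_i\succcurlyeq A_j$ then $v_i^\ast-v_j^\ast\ge\nu$; - for all $j$, $\ \lambda\,\Big|\frac{F(B_j)-F(B_{j-1})}{|A_j|}\Big|\le\nu/4$. Then for every $z\in\mathbb R^p$ the problem $\min_{w\in\mathbb R^p}\frac12\|w-z\|_2^2+\lambda f(w)$ has a unique minimizer; and for $z=w^\ast+\sigma\varepsilon$, the lattice $\mathcal D$ is associated to this minimizer $\hat w$ with probability at least $$1-\sum_{j=1}^m\exp\Big(-\frac{\nu^2|A_j|}{32\sigma^2}\Big)-2\sum_{j=1}^m|A_j|\exp\Big(-\frac{\lambda^2\eta_j^2}{2\sigma^2|A_j|^2}\Big).$$ -/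

import Mathlib

open MeasureTheory ProbabilityTheory

noncomputable section

namespace LevelSet

variable {p : ℕ}

/-- A submodular set-function on the subsets of `V = Fin p`, vanishing at `∅` and at `V`, and
positive at every other set. -/
structure IsPenalty (F : Finset (Fin p) → ℝ) : Prop where
  submodular : ∀ A B, F (A ∪ B) + F (A ∩ B) ≤ F A + F B
  empty : F ∅ = 0
  univ : F Finset.univ = 0
  pos : ∀ A, A ≠ ∅ → A ≠ Finset.univ → 0 < F A

/-- The level set `{w ≥ α}`. -/
def levelSet (w : EuclideanSpace ℝ (Fin p)) (α : ℝ) : Finset (Fin p) :=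
  Finset.univ.filter fun k => α ≤ w k

/-- The Lovász extension `f(w) = ∫ F({w ≥ α}) dα`. The integrand is bounded, and zero outside a
bounded interval when `F` vanishes at `∅` and at `V`. -/
def lovasz (F : Finset (Fin p) → ℝ) (w : EuclideanSpace ℝ (Fin p)) : ℝ :=
  ∫ α : ℝ, F (levelSet w α)

/-- The objective `½ ‖w - z‖² + λ f(w)` of the proximal problem. -/
def proxObjective (F : Finset (Fin p) → ℝ) (lam : ℝ) (z w : EuclideanSpace ℝ (Fin p)) : ℝ :=
  1 / 2 * ‖w - z‖ ^ 2 + lam * lovasz F w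

/-- `w` is a global minimizer of the proximal problem. -/
def IsProxSolution (F : Finset (Fin p) → ℝ) (lam : ℝ) (z w : EuclideanSpace ℝ (Fin p)) : Prop :=
  ∀ u, proxObjective F lam z w ≤ proxObjective F lam z u

/-- A (distributive) lattice of subsets of `V`: closed under union and intersection, and containing
`∅` and `V`. -/
structure IsSetLattice (D : Set (Finset (Fin p))) : Prop where
  empty_mem : ∅ ∈ D
  univ_mem : Finset.univ ∈ D
  union_mem : ∀ S ∈ D, ∀ T ∈ D, S ∪ T ∈ D
  inter_mem : ∀ S ∈ D, ∀ T ∈ D, S ∩ T ∈ D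

/-- The elements of the poset `Π(D)`: the differences of consecutive sets in maximal chains of `D`,
that is, the sets `T \ S` where `T` covers `S` in `D`. -/
def IsBlock (D : Set (Finset (Fin p))) (A : Finset (Fin p)) : Prop :=
  ∃ S ∈ D, ∃ T ∈ D, S ⊂ T ∧ (∀ U ∈ D, S ⊆ U → U ⊆ T → U = S ∨ U = T) ∧ A = T \ S

/-- The order `A ≽ A'` on `Π(D)`: every member of `D` that contains `A'` contains `A`. Members of
`D` play the role of level sets `{w ≥ α}`, so larger elements carry larger values. -/
def BlockGE (D : Set (Finset (Fin p))) (A A' : Finset (Fin p)) : Prop :=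
  ∀ S ∈ D, A' ⊆ S → A ⊆ S

/-- The union of all (strict) ancestors of `A` in `Π(D)`. -/
def ancestors (D : Set (Finset (Fin p))) (A : Finset (Fin p)) : Finset (Fin p) :=
  open Classical in
  Finset.univ.filter fun k => ∃ A', IsBlock D A' ∧ A' ≠ A ∧ BlockGE D A' A ∧ k ∈ A'

/-- The set `U°_D`: `w` is constant on each element of `Π(D)`, and strictly larger on strictly larger
elements. -/
def InOpenFace (D : Set (Finset (Fin p))) (w : EuclideanSpace ℝ (Fin p)) : Prop :=
  (∀ A, IsBlock D A → ∀ k ∈ A, ∀ l ∈ A, w k = w l) ∧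
  ∀ A A', IsBlock D A → IsBlock D A' → A ≠ A' → BlockGE D A A' →
    ∀ k ∈ A, ∀ l ∈ A', w l < w k

/-- `A` is separable for `G` if it splits into two nonempty parts on which `G` is additive. -/
def Separable (G : Finset (Fin p) → ℝ) (A : Finset (Fin p)) : Prop :=
  ∃ B C : Finset (Fin p), B ≠ ∅ ∧ C ≠ ∅ ∧ Disjoint B C ∧ B ∪ C = A ∧ G A = G B + G C

/-- Lattices on which `F` is modular and whose blocks are inseparable for the contraction of `F` by
the union of their ancestors. -/
structure IsPreAllowed (F : Finset (Fin p) → ℝ) (D : Set (Finset (Fin p))) : Prop where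
  lattice : IsSetLattice D
  modular : ∀ S ∈ D, ∀ T ∈ D, F S + F T = F (S ∪ T) + F (S ∩ T)
  inseparable : ∀ A, IsBlock D A →
    ¬ Separable (fun C => F (ancestors D A ∪ C) - F (ancestors D A)) A

/-- The lattices `D` for which `U°_D` is the relative interior of a face of `{w | f(w) ≤ 1}` up to
scaling: those of `IsPreAllowed` that are maximal among the ones with the same unordered partition
into blocks. -/
structure IsAllowed (F : Finset (Fin p) → ℝ) (D : Set (Finset (Fin p))) : Prop
    extends IsPreAllowed F D where
  maximal : ∀ D' : Set (Finset (Fin p)), IsPreAllowed F D' →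
    (∀ A, IsBlock D' A ↔ IsBlock D A) → D ⊆ D' → D' = D

/-- `D` is the lattice associated to `w`. -/
def IsAssociated (F : Finset (Fin p) → ℝ) (D : Set (Finset (Fin p)))
    (w : EuclideanSpace ℝ (Fin p)) : Prop :=
  IsAllowed F D ∧ InOpenFace D w

/-- `A 0, …, A (m - 1)` enumerates the elements of `Π(D)`, without repetition and in a topological
order (ancestors first). -/
structure IsTopologicalOrdering (D : Set (Finset (Fin p))) {m : ℕ}
    (A : Fin m → Finset (Fin p)) : Prop where
  injective : Function.Injective A
  isBlock_iff : ∀ S, IsBlock D S ↔ ∃ j, A j = S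
  topological : ∀ i j, BlockGE D (A i) (A j) → i ≤ j

/-- The union of the first `n` blocks. With blocks indexed from `0`, the block `A j` is preceded by
`prefixUnion A j`, and `prefixUnion A (j + 1)` includes it. -/
def prefixUnion {m : ℕ} (A : Fin m → Finset (Fin p)) (n : ℕ) : Finset (Fin p) :=
  (Finset.univ.filter fun i : Fin m => (i : ℕ) < n).biUnion A

end LevelSet

end

namespace LevelSet

variable {p : ℕ}

/-! ### The Lovász extension as a support function -/

/-! The proof exhibits the minimizer on a good event. By a layer-cake formula and the greedy
algorithm, the Lovász extension is the support function of the base polytope `{s | s(V) = 0, s(C) ≤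
F(C)}`. Hence `w` is optimal as soon as `s = z - w` satisfies `s(V) = 0`, `s ≤ λF`, and `s = λF` on
every level set of `w` (`isProxSolution_of_subgradient`).

The candidate takes on `A_j` the average of `z` minus the slope `λ(F(B_j) - F(B_{j-1}))/|A_j|`, so
its residual there is the centred noise plus that slope. The residual has the increments of `λF` as
block sums, and modularity makes it agree with `λF` on `D` (`sum_eq_of_modular`). By submodularity,
domination by `λF` need only be checked block by block (`sum_le_of_sum_inter_le`), where the margin
`η_j` absorbs centred noise of size at most `λη_j/|A_j|` (`sum_noise_add_slope_le`). If every block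
average of the noise is below `ν/4`, the gap `ν` survives two averages and two slopes. The candidate
then lies in the open face of `D`, its level sets belong to `D`, and uniqueness identifies it with
the minimizer.

Being allowed does not involve the vector, so only the open face condition is random. A union bound
over Gaussian tails finishes the proof. -/

lemma levelSet_eq_empty {u : EuclideanSpace ℝ (Fin p)} {α : ℝ} (h : ∑ k, |u k| < α) :
    levelSet u α = ∅ := by
  refine Finset.filter_eq_empty_iff.2 fun k _ hk => ?_
  have := Finset.single_le_sum (f := fun k => |u k|) (fun i _ => abs_nonneg _) (Finset.mem_univ k)
  have := le_abs_self (u k)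
  simp only at *
  linarith

lemma levelSet_eq_univ {u : EuclideanSpace ℝ (Fin p)} {α : ℝ} (h : α ≤ -∑ k, |u k|) :
    levelSet u α = Finset.univ := by
  refine Finset.filter_true_of_mem fun k _ => ?_
  have := Finset.single_le_sum (f := fun k => |u k|) (fun i _ => abs_nonneg _) (Finset.mem_univ k)
  have := neg_abs_le (u k)
  simp only at *
  linarith

lemma measurable_comp_levelSet (G : Finset (Fin p) → ℝ) (u : EuclideanSpace ℝ (Fin p)) :
    Measurable fun α => G (levelSet u α) := by
  classical
  have h : (fun α => G (levelSet u α)) =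
      fun α => ∑ S : Finset (Fin p), {α | ∀ k, k ∈ S ↔ α ≤ u k}.indicator (fun _ => G S) α := by
    funext α
    rw [Finset.sum_eq_single (levelSet u α)]
    · rw [Set.indicator_of_mem]
      simp [levelSet]
    · intro S _ hS
      rw [Set.indicator_of_notMem]
      exact fun h => hS (by ext k; simpa [levelSet] using h k)
    · simp
  rw [h]
  refine Finset.measurable_sum _ fun S _ => measurable_const.indicator ?_
  have : {α | ∀ k, k ∈ S ↔ α ≤ u k} = ⋂ k, {α | k ∈ S ↔ α ≤ u k} := by ext; simp
  rw [this]
  refine MeasurableSet.iInter fun k => ?_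
  by_cases hk : k ∈ S
  · simp only [hk, true_iff]
    exact measurableSet_Iic
  · simp only [hk, false_iff, not_le]
    exact measurableSet_Ioi

lemma integrable_comp_levelSet {G : Finset (Fin p) → ℝ} (h0 : G ∅ = 0) (h1 : G Finset.univ = 0)
    (u : EuclideanSpace ℝ (Fin p)) : Integrable fun α => G (levelSet u α) := by
  set M := ∑ k, |u k|
  have hi : IntegrableOn (fun α => G (levelSet u α)) (Set.Icc (-M) M) := by
    refine Measure.integrableOn_of_bounded (M := ∑ S, |G S|) (by simp)
      (measurable_comp_levelSet G u).aestronglyMeasurable (ae_of_all _ fun α => ?_)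
    exact Finset.single_le_sum (f := fun S => |G S|) (fun i _ => abs_nonneg _) (Finset.mem_univ _)
  refine (integrableOn_iff_integrable_of_support_subset ?_).1 hi
  intro α hα
  by_contra hc
  refine hα ?_
  beta_reduce
  rcases not_and_or.1 hc with h | h
  · rw [levelSet_eq_univ (not_le.1 h).le, h1]
  · rw [levelSet_eq_empty (not_le.1 h), h0]

/-- Layer-cake formula: `s k * (u k + M)` is the integral of `s k` over `(-M, u k]`, and the shifts
by `M` cancel because `s` sums to zero. -/
lemma sum_mul_eq_integral {s : Fin p → ℝ} (hs : ∑ k, s k = 0) (u : EuclideanSpace ℝ (Fin p)) :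
    ∑ k, s k * u k = ∫ α, ∑ k ∈ levelSet u α, s k := by
  set M := ∑ k, |u k|
  have hM : ∀ k, -M ≤ u k := fun k => by
    have := Finset.single_le_sum (f := fun k => |u k|) (fun i _ => abs_nonneg _) (Finset.mem_univ k)
    have := neg_abs_le (u k)
    simp only at *
    linarith
  have h : (fun α => ∑ k ∈ levelSet u α, s k) =
      fun α => ∑ k, (Set.Ioc (-M) (u k)).indicator (fun _ => s k) α := by
    funext α
    rcases le_or_gt α (-M) with h | h
    · rw [levelSet_eq_univ h, hs]
      exact (Finset.sum_eq_zero fun k _ => Set.indicator_of_notMem (fun h' => h'.1.not_ge h) _).symm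
    · rw [levelSet, Finset.sum_filter]
      refine Finset.sum_congr rfl fun k _ => ?_
      simp [Set.indicator, h]
  rw [h, integral_finsetSum]
  · have : ∀ k, ∫ α, (Set.Ioc (-M) (u k)).indicator (fun _ => s k) α = s k * u k + s k * M := by
      intro k
      rw [integral_indicator_const _ measurableSet_Ioc, Real.volume_real_Ioc_of_le (hM k),
        smul_eq_mul]
      ring
    simp_rw [this, Finset.sum_add_distrib, ← Finset.sum_mul, hs]
    simp
  · intro k _
    exact (integrable_indicator_iff measurableSet_Ioc).2 (integrableOn_const (by simp))

lemma sum_mul_le_lovasz {G : Finset (Fin p) → ℝ} (h0 : G ∅ = 0) (h1 : G Finset.univ = 0)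
    {s : Fin p → ℝ} (hs : ∑ k, s k = 0) (hsG : ∀ C, ∑ k ∈ C, s k ≤ G C)
    (u : EuclideanSpace ℝ (Fin p)) : ∑ k, s k * u k ≤ lovasz G u := by
  rw [sum_mul_eq_integral hs]
  exact integral_mono (integrable_comp_levelSet (G := fun S => ∑ k ∈ S, s k) (by simp) hs u)
    (integrable_comp_levelSet h0 h1 u) fun α => hsG _

lemma sum_mul_eq_lovasz {G : Finset (Fin p) → ℝ} {s : Fin p → ℝ} (hs : ∑ k, s k = 0)
    {u : EuclideanSpace ℝ (Fin p)} (h : ∀ α, ∑ k ∈ levelSet u α, s k = G (levelSet u α)) :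
    ∑ k, s k * u k = lovasz G u := by
  rw [sum_mul_eq_integral hs, lovasz]
  simp_rw [h]

lemma lovasz_const_mul (c : ℝ) (F : Finset (Fin p) → ℝ) (u : EuclideanSpace ℝ (Fin p)) :
    lovasz (fun S => c * F S) u = c * lovasz F u :=
  integral_const_mul _ _

/-! ### Telescoping along an ordered partition -/

lemma mem_prefixUnion {m : ℕ} {A : Fin m → Finset (Fin p)} {n : ℕ} {k : Fin p} :
    k ∈ prefixUnion A n ↔ ∃ i : Fin m, (i : ℕ) < n ∧ k ∈ A i := by
  simp [prefixUnion]

lemma prefixUnion_zero {m : ℕ} (A : Fin m → Finset (Fin p)) : prefixUnion A 0 = ∅ := by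
  ext; simp [mem_prefixUnion]

lemma prefixUnion_succ {m : ℕ} (A : Fin m → Finset (Fin p)) (j : Fin m) :
    prefixUnion A (j + 1) = prefixUnion A j ∪ A j := by
  ext k
  simp only [mem_prefixUnion, Finset.mem_union]
  constructor
  · rintro ⟨i, hi, hk⟩
    rcases (Nat.lt_succ_iff_lt_or_eq.1 hi) with h | h
    · exact Or.inl ⟨i, h, hk⟩
    · rw [Fin.ext h] at hk
      exact Or.inr hk
  · rintro (⟨i, hi, hk⟩ | hk)
    · exact ⟨i, by omega, hk⟩
    · exact ⟨j, by omega, hk⟩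

lemma prefixUnion_last {m : ℕ} {A : Fin m → Finset (Fin p)} (hA : ∀ k, ∃! j, k ∈ A j) :
    prefixUnion A m = Finset.univ := by
  ext k
  obtain ⟨j, hj, -⟩ := hA k
  simpa [mem_prefixUnion] using ⟨j, hj⟩

lemma sum_eq_sum_inter {m : ℕ} {A : Fin m → Finset (Fin p)} (hA : ∀ k, ∃! j, k ∈ A j)
    (s : Fin p → ℝ) (S : Finset (Fin p)) : ∑ k ∈ S, s k = ∑ j, ∑ k ∈ S ∩ A j, s k := by
  rw [← Finset.sum_biUnion]
  · refine Finset.sum_congr ?_ fun _ _ => rfl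
    ext k
    obtain ⟨j, hj, -⟩ := hA k
    simp only [Finset.mem_biUnion, Finset.mem_univ, true_and, Finset.mem_inter]
    exact ⟨fun h => ⟨j, h, hj⟩, fun ⟨_, h, _⟩ => h⟩
  · intro i _ j _ hij
    refine Finset.disjoint_left.2 fun k hi hj => hij ?_
    exact (hA k).unique (Finset.mem_inter.1 hi).2 (Finset.mem_inter.1 hj).2

lemma eq_sum_sub_prefixUnion {m : ℕ} {A : Fin m → Finset (Fin p)} (hA : ∀ k, ∃! j, k ∈ A j)
    {G : Finset (Fin p) → ℝ} (h0 : G ∅ = 0) (S : Finset (Fin p)) :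
    G S = ∑ j : Fin m, (G (S ∩ prefixUnion A (j + 1)) - G (S ∩ prefixUnion A j)) := by
  rw [Fin.sum_univ_eq_sum_range (fun n => G (S ∩ prefixUnion A (n + 1)) - G (S ∩ prefixUnion A n)) m,
    Finset.sum_range_sub (fun n => G (S ∩ prefixUnion A n)), prefixUnion_zero, prefixUnion_last hA]
  simp [h0]

/-- A vector dominated by the increments of a submodular function along an ordered partition is
dominated by the function. -/
lemma sum_le_of_sum_inter_le {m : ℕ} {A : Fin m → Finset (Fin p)} (hA : ∀ k, ∃! j, k ∈ A j)
    {G : Finset (Fin p) → ℝ} (h0 : G ∅ = 0)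
    (hG : ∀ X Y, G (X ∪ Y) + G (X ∩ Y) ≤ G X + G Y) {s : Fin p → ℝ}
    (hs : ∀ j, ∀ C ⊆ A j, ∑ k ∈ C, s k ≤ G (prefixUnion A j ∪ C) - G (prefixUnion A j))
    (S : Finset (Fin p)) : ∑ k ∈ S, s k ≤ G S := by
  rw [sum_eq_sum_inter hA, eq_sum_sub_prefixUnion hA h0 S]
  refine Finset.sum_le_sum fun j _ => (hs j _ Finset.inter_subset_right).trans ?_
  have h := hG (S ∩ prefixUnion A (j + 1)) (prefixUnion A j)
  have e1 : S ∩ prefixUnion A (j + 1) ∪ prefixUnion A j = prefixUnion A j ∪ S ∩ A j := by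
    rw [prefixUnion_succ]; ext; simp only [Finset.mem_union, Finset.mem_inter]; tauto
  have e2 : S ∩ prefixUnion A (j + 1) ∩ prefixUnion A j = S ∩ prefixUnion A j := by
    rw [prefixUnion_succ]; ext; simp only [Finset.mem_union, Finset.mem_inter]; tauto
  rw [e1, e2] at h
  linarith

/-! ### Greedy vectors and convexity -/

/-- Edmonds' greedy algorithm: with coordinates sorted decreasingly, `s` records the marginal gains
of `F` along the resulting chain. Submodularity gives domination. Level sets of `w` are initial
segments of the chain, so the gains telescope to `F` on them. -/
lemma exists_greedy {F : Finset (Fin p) → ℝ} (hF : IsPenalty F) (w : EuclideanSpace ℝ (Fin p)) :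
    ∃ s : Fin p → ℝ, (∑ k, s k = 0) ∧ (∀ C, ∑ k ∈ C, s k ≤ F C) ∧
      ∑ k, s k * w k = lovasz F w := by
  classical
  let e : Equiv.Perm (Fin p) := Tuple.sort fun k => -w k
  have he : ∀ i j, i ≤ j → w (e j) ≤ w (e i) := fun i j hij => by
    have := Tuple.monotone_sort (fun k => -w k) hij
    simp only [Function.comp] at this
    exact neg_le_neg_iff.1 this
  let A : Fin p → Finset (Fin p) := fun j => {e j}
  have hA : ∀ k, ∃! j, k ∈ A j := fun k =>
    ⟨e.symm k, by simp [A], fun j hj => by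
      simp only [A, Finset.mem_singleton] at hj; simp [hj]⟩
  let s : Fin p → ℝ := fun k =>
    F (prefixUnion A (e.symm k + 1)) - F (prefixUnion A (e.symm k))
  have hle : ∀ C, ∑ k ∈ C, s k ≤ F C := by
    refine sum_le_of_sum_inter_le hA hF.empty hF.submodular fun j C hC => ?_
    rcases Finset.subset_singleton_iff.1 hC with rfl | rfl
    · simp
    · simp only [Finset.sum_singleton, s, Equiv.symm_apply_apply, prefixUnion_succ]
      exact le_rfl
  have heq : ∀ α, ∑ k ∈ levelSet w α, s k = F (levelSet w α) := by
    intro α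
    rw [sum_eq_sum_inter hA, eq_sum_sub_prefixUnion hA hF.empty]
    refine Finset.sum_congr rfl fun j _ => ?_
    by_cases hj : α ≤ w (e j)
    · have h1 : levelSet w α ∩ A j = {e j} := by
        ext k; simp only [levelSet, A, Finset.mem_inter, Finset.mem_filter, Finset.mem_univ,
          true_and, Finset.mem_singleton]
        exact ⟨fun h => h.2, fun h => ⟨h ▸ hj, h⟩⟩
      have h2 : prefixUnion A (j + 1) ⊆ levelSet w α := by
        intro k hk
        obtain ⟨i, hi, hk⟩ := mem_prefixUnion.1 hk
        simp only [A, Finset.mem_singleton] at hk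
        simp only [levelSet, Finset.mem_filter, Finset.mem_univ, true_and, hk]
        exact hj.trans (he i j (Nat.lt_succ_iff.1 hi))
      have h3 : prefixUnion A j ⊆ levelSet w α :=
        (prefixUnion_succ A j ▸ Finset.subset_union_left).trans h2
      rw [h1, Finset.inter_eq_right.2 h2, Finset.inter_eq_right.2 h3]
      simp [s]
    · have h1 : levelSet w α ∩ A j = ∅ := by
        ext k; simp only [levelSet, A, Finset.mem_inter, Finset.mem_filter, Finset.mem_univ,
          true_and, Finset.mem_singleton, Finset.notMem_empty, iff_false]
        exact fun h => hj (h.2 ▸ h.1)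
      rw [prefixUnion_succ, Finset.inter_union_distrib_left, h1]
      simp
  have hs : ∑ k, s k = 0 := by
    rw [sum_eq_sum_inter hA, ← hF.univ, eq_sum_sub_prefixUnion hA hF.empty]
    refine Finset.sum_congr rfl fun j _ => ?_
    simp [A, s]
  exact ⟨s, hs, hle, sum_mul_eq_lovasz hs heq⟩

lemma IsPenalty.nonneg {F : Finset (Fin p) → ℝ} (hF : IsPenalty F) (S : Finset (Fin p)) :
    0 ≤ F S := by
  by_cases h0 : S = ∅
  · rw [h0, hF.empty]
  by_cases h1 : S = Finset.univ
  · rw [h1, hF.univ]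
  exact (hF.pos S h0 h1).le

/-- The greedy vector at the convex combination is a linear minorant of the Lovász extension that is
tight at that point. -/
lemma convexOn_lovasz {F : Finset (Fin p) → ℝ} (hF : IsPenalty F) :
    ConvexOn ℝ Set.univ (lovasz F) := by
  refine ⟨convex_univ, fun w _ u _ a b ha hb _ => ?_⟩
  obtain ⟨s, hs, hle, heq⟩ := exists_greedy hF (a • w + b • u)
  have hw := sum_mul_le_lovasz hF.empty hF.univ hs hle w
  have hu := sum_mul_le_lovasz hF.empty hF.univ hs hle u
  have : ∑ k, s k * (a • w + b • u) k = a * ∑ k, s k * w k + b * ∑ k, s k * u k := by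
    rw [Finset.mul_sum, Finset.mul_sum, ← Finset.sum_add_distrib]
    refine Finset.sum_congr rfl fun k _ => ?_
    simp only [PiLp.add_apply, PiLp.smul_apply, smul_eq_mul]
    ring
  rw [← heq, this, smul_eq_mul, smul_eq_mul]
  gcongr

/-! ### The proximal problem -/

/-- Existence is coercivity: the penalty is nonnegative and the quadratic term is proper. Uniqueness
is strong convexity, read off from the parallelogram law at the midpoint of two minimizers. -/
theorem existsUnique_isProxSolution {F : Finset (Fin p) → ℝ} (hF : IsPenalty F) {lam : ℝ}
    (hlam : 0 ≤ lam) (z : EuclideanSpace ℝ (Fin p)) : ∃! w, IsProxSolution F lam z w := by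
  have hcont : Continuous (lovasz F) :=
    continuousOn_univ.1 ((convexOn_lovasz hF).continuousOn isOpen_univ)
  have hc : Continuous (proxObjective F lam z) := by
    unfold proxObjective
    fun_prop
  have htend : Filter.Tendsto (proxObjective F lam z) (Filter.cocompact _) Filter.atTop := by
    have h1 : Filter.Tendsto (fun w : EuclideanSpace ℝ (Fin p) => ‖w - z‖)
        (Filter.cocompact _) Filter.atTop :=
      tendsto_norm_cocompact_atTop.comp (Homeomorph.subRight z).isClosedEmbedding.tendsto_cocompact
    have h2 := ((Filter.tendsto_pow_atTop (two_ne_zero)).comp h1).const_mul_atTop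
      (show (0 : ℝ) < 1 / 2 by norm_num)
    refine Filter.tendsto_atTop_mono (fun w => ?_) h2
    have : 0 ≤ lam * lovasz F w := mul_nonneg hlam (integral_nonneg fun α => hF.nonneg _)
    simp only [Function.comp, proxObjective]
    linarith
  obtain ⟨w, hw⟩ := hc.exists_forall_le htend
  refine ⟨w, hw, fun u hu => ?_⟩
  have hconv := (convexOn_lovasz hF).2 (Set.mem_univ w) (Set.mem_univ u)
    (show (0 : ℝ) ≤ 1 / 2 by norm_num) (show (0 : ℝ) ≤ 1 / 2 by norm_num) (by norm_num)
  set c := (1 / 2 : ℝ) • w + (1 / 2 : ℝ) • u with hcdef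
  have hcw := hw c
  have hcu := hu c
  have hpar := parallelogram_law_with_norm ℝ (w - z) (u - z)
  have e1 : w - z + (u - z) = (2 : ℝ) • (c - z) := by
    rw [hcdef]; module
  have e2 : w - z - (u - z) = w - u := by abel
  rw [e1, e2, norm_smul] at hpar
  simp only [Real.norm_eq_abs, abs_two, smul_eq_mul] at hpar hconv
  have hconv' := mul_le_mul_of_nonneg_left hconv hlam
  simp only [proxObjective] at hcw hcu
  have : ‖w - u‖ = 0 := by nlinarith [norm_nonneg (w - u), norm_nonneg (c - z)]
  exact (sub_eq_zero.1 (norm_eq_zero.1 this)).symm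

/-- If `z - w` is a subgradient of `λ f` at `w`, then `w` minimizes the proximal objective. -/
theorem isProxSolution_of_subgradient {F : Finset (Fin p) → ℝ} (hF : IsPenalty F) {lam : ℝ}
    {z w : EuclideanSpace ℝ (Fin p)} (hs : ∑ k, (z k - w k) = 0)
    (hle : ∀ C, ∑ k ∈ C, (z k - w k) ≤ lam * F C)
    (heq : ∀ α, ∑ k ∈ levelSet w α, (z k - w k) = lam * F (levelSet w α)) :
    IsProxSolution F lam z w := by
  intro u
  have h1 := sum_mul_le_lovasz (G := fun S => lam * F S) (by simp [hF.empty]) (by simp [hF.univ])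
    hs hle u
  have h2 := sum_mul_eq_lovasz (G := fun S => lam * F S) hs heq
  rw [lovasz_const_mul] at h1 h2
  simp only [proxObjective, EuclideanSpace.real_norm_sq_eq, PiLp.sub_apply]
  have h3 : 0 ≤ ∑ k, 1 / 2 * (u k - w k) ^ 2 := Finset.sum_nonneg fun k _ => by positivity
  -- Completing the square: with `s = z - w`, the objective at `u` minus that at `w` is `½‖u - w‖²`
  -- plus `λf(u) - ⟨s, u⟩`, minus `λf(w) - ⟨s, w⟩`. The last difference vanishes and the one before
  -- is nonnegative.
  have h4 : ∑ k, 1 / 2 * (u k - w k) ^ 2 = 1 / 2 * ∑ k, (u k - z k) ^ 2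
      - 1 / 2 * ∑ k, (w k - z k) ^ 2 + ∑ k, (z k - w k) * u k - ∑ k, (z k - w k) * w k := by
    simp only [Finset.mul_sum, ← Finset.sum_sub_distrib, ← Finset.sum_add_distrib]
    exact Finset.sum_congr rfl fun k _ => by ring
  linarith

/-! ### Blocks of a lattice of sets -/

section Lattice

variable {D : Set (Finset (Fin p))}

lemma IsSetLattice.biUnion_mem (hD : IsSetLattice D) {ι : Type*} (I : Finset ι)
    {T : ι → Finset (Fin p)} (hT : ∀ i ∈ I, T i ∈ D) : I.biUnion T ∈ D := by
  classical
  induction I using Finset.induction_on with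
  | empty => simpa using hD.empty_mem
  | insert a I _ ih =>
    rw [Finset.biUnion_insert]
    exact hD.union_mem _ (hT a (Finset.mem_insert_self a I)) _
      (ih fun i hi => hT i (Finset.mem_insert_of_mem hi))

lemma IsSetLattice.exists_least (hD : IsSetLattice D) (x : Fin p) :
    ∃ T ∈ D, x ∈ T ∧ ∀ U ∈ D, x ∈ U → T ⊆ U := by
  classical
  obtain ⟨T, hT, hmin⟩ := Finset.exists_min_image
    (Finset.univ.filter fun U : Finset (Fin p) => U ∈ D ∧ x ∈ U) Finset.card
    ⟨Finset.univ, by simpa using hD.univ_mem⟩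
  simp only [Finset.mem_filter, Finset.mem_univ, true_and] at hT hmin
  refine ⟨T, hT.1, hT.2, fun U hU hx => ?_⟩
  have h := hmin (T ∩ U) ⟨hD.inter_mem _ hT.1 _ hU, Finset.mem_inter.2 ⟨hT.2, hx⟩⟩
  exact Finset.inter_eq_left.1 (Finset.eq_of_subset_of_card_le Finset.inter_subset_left h)

/-- The block is `T \ S`, where `T` is the least member containing `x` and `S` is the largest member
inside `T` that avoids `x`. Any member between them equals `T` or `S` according to whether it
contains `x`. -/
lemma IsSetLattice.exists_isBlock_mem (hD : IsSetLattice D) (x : Fin p) :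
    ∃ A, IsBlock D A ∧ x ∈ A := by
  classical
  obtain ⟨T, hT, hxT, hmin⟩ := hD.exists_least x
  set S := (Finset.univ.filter fun U : Finset (Fin p) => U ∈ D ∧ U ⊆ T ∧ x ∉ U).biUnion id
  have hS : S ∈ D := hD.biUnion_mem _ fun U hU => (Finset.mem_filter.1 hU).2.1
  have hxS : x ∉ S := by simp [S]
  have hST : S ⊆ T := by
    refine Finset.biUnion_subset.2 fun U hU => (Finset.mem_filter.1 hU).2.2.1
  refine ⟨T \ S, ⟨S, hS, T, hT, ⟨hST, fun h => hxS (h hxT)⟩, fun U hU h1 h2 => ?_, rfl⟩,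
    Finset.mem_sdiff.2 ⟨hxT, hxS⟩⟩
  by_cases hx : x ∈ U
  · exact Or.inr (h2.antisymm (hmin U hU hx))
  · refine Or.inl (Finset.Subset.antisymm ?_ h1)
    exact Finset.subset_biUnion_of_mem id
      (Finset.mem_filter.2 ⟨Finset.mem_univ _, hU, h2, hx⟩)

lemma IsBlock.nonempty {A : Finset (Fin p)} (hA : IsBlock D A) : A.Nonempty := by
  obtain ⟨S, -, T, -, hST, -, rfl⟩ := hA
  exact Finset.sdiff_nonempty.2 hST.2

/-- For a block `T \ S`, the member `S ∪ (U ∩ T)` lies between `S` and `T` and contains `x`, so it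
must be `T`. -/
lemma IsBlock.subset_of_mem (hD : IsSetLattice D) {A U : Finset (Fin p)} (hA : IsBlock D A)
    (hU : U ∈ D) {x : Fin p} (hxA : x ∈ A) (hxU : x ∈ U) : A ⊆ U := by
  obtain ⟨S, hS, T, hT, hST, hcov, rfl⟩ := hA
  rw [Finset.mem_sdiff] at hxA
  rcases hcov (S ∪ U ∩ T) (hD.union_mem _ hS _ (hD.inter_mem _ hU _ hT)) Finset.subset_union_left
    (Finset.union_subset hST.1 Finset.inter_subset_right) with h | h
  · exact absurd (h ▸ Finset.mem_union_right S (Finset.mem_inter.2 ⟨hxU, hxA.1⟩)) hxA.2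
  · intro y hy
    rw [Finset.mem_sdiff, ← h, Finset.mem_union, Finset.mem_inter] at hy
    tauto

lemma IsBlock.subset_of_mem_block (hD : IsSetLattice D) {A A' : Finset (Fin p)} (hA : IsBlock D A)
    (hA' : IsBlock D A') {x : Fin p} (hx : x ∈ A) (hx' : x ∈ A') : A ⊆ A' := by
  obtain ⟨S, hS, T, hT, hST, hcov, rfl⟩ := hA'
  rw [Finset.mem_sdiff] at hx'
  intro y hy
  exact Finset.mem_sdiff.2 ⟨hA.subset_of_mem hD hT hx hx'.1 hy,
    fun hyS => hx'.2 (hA.subset_of_mem hD hS hy hyS hx)⟩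

lemma IsBlock.eq_of_mem (hD : IsSetLattice D) {A A' : Finset (Fin p)} (hA : IsBlock D A)
    (hA' : IsBlock D A') {x : Fin p} (hx : x ∈ A) (hx' : x ∈ A') : A = A' :=
  (hA.subset_of_mem_block hD hA' hx hx').antisymm (hA'.subset_of_mem_block hD hA hx' hx)

lemma IsTopologicalOrdering.existsUnique_mem (hD : IsSetLattice D) {m : ℕ}
    {A : Fin m → Finset (Fin p)} (hA : IsTopologicalOrdering D A) (k : Fin p) :
    ∃! j, k ∈ A j := by
  obtain ⟨B, hB, hk⟩ := hD.exists_isBlock_mem k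
  obtain ⟨j, rfl⟩ := (hA.isBlock_iff B).1 hB
  exact ⟨j, hk, fun i hi => hA.injective
    (((hA.isBlock_iff _).2 ⟨i, rfl⟩).eq_of_mem hD hB hi hk)⟩

/-- A union of blocks that is closed under passing to ancestors belongs to the lattice. -/
lemma IsSetLattice.mem_of_upper (hD : IsSetLattice D) {W : Finset (Fin p)}
    (hW : ∀ B B', IsBlock D B → IsBlock D B' → BlockGE D B B' →
      ∀ k ∈ B, ∀ l ∈ B', l ∈ W → k ∈ W) : W ∈ D := by
  choose T hT hxT hmin using hD.exists_least
  -- Birkhoff's argument: `y` lies in the least member containing `x` only if the block of `y` is an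
  -- ancestor of, or equal to, the block of `x`. Hence `W` is the union of these least members.
  have : W = W.biUnion T := by
    refine Finset.Subset.antisymm (fun x hx => Finset.mem_biUnion.2 ⟨x, hx, hxT x⟩) ?_
    refine Finset.biUnion_subset.2 fun x hx y hy => ?_
    obtain ⟨B', hB', hxB'⟩ := hD.exists_isBlock_mem x
    obtain ⟨B, hB, hyB⟩ := hD.exists_isBlock_mem y
    refine hW B B' hB hB' (fun U hU hBU => ?_) y hyB x hxB' hx
    exact hB.subset_of_mem hD hU hyB (hmin x U hU (hBU hxB') hy)
  rw [this]
  exact hD.biUnion_mem _ fun i _ => hT i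

lemma IsTopologicalOrdering.prefixUnion_mem (hD : IsSetLattice D) {m : ℕ}
    {A : Fin m → Finset (Fin p)} (hA : IsTopologicalOrdering D A) (n : ℕ) :
    prefixUnion A n ∈ D := by
  refine hD.mem_of_upper fun B B' hB hB' hge k hk l hl hlW => ?_
  obtain ⟨i, rfl⟩ := (hA.isBlock_iff B).1 hB
  obtain ⟨j, rfl⟩ := (hA.isBlock_iff B').1 hB'
  obtain ⟨j', hj', hl'⟩ := mem_prefixUnion.1 hlW
  obtain rfl := (hA.existsUnique_mem hD l).unique hl hl'
  exact mem_prefixUnion.2 ⟨i, lt_of_le_of_lt (hA.topological i j hge) hj', hk⟩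

lemma InOpenFace.levelSet_mem (hD : IsSetLattice D) {w : EuclideanSpace ℝ (Fin p)}
    (hw : InOpenFace D w) (α : ℝ) : levelSet w α ∈ D := by
  refine hD.mem_of_upper fun B B' hB hB' hge k hk l hl hlW => ?_
  simp only [levelSet, Finset.mem_filter, Finset.mem_univ, true_and] at hlW ⊢
  by_cases h : B = B'
  · rw [hw.1 B hB k hk l (h ▸ hl)]
    exact hlW
  · exact hlW.trans (hw.2 B B' hB hB' h hge k hk l hl).le

/-- A vector that sums to the increments of `G` over the blocks agrees with `G` on a lattice on
which `G` is modular. -/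
lemma sum_eq_of_modular (hD : IsSetLattice D) {m : ℕ} {A : Fin m → Finset (Fin p)}
    (hA : IsTopologicalOrdering D A) {G : Finset (Fin p) → ℝ} (h0 : G ∅ = 0)
    (hG : ∀ S ∈ D, ∀ T ∈ D, G S + G T = G (S ∪ T) + G (S ∩ T)) {s : Fin p → ℝ}
    (hs : ∀ j : Fin m, ∑ k ∈ A j, s k = G (prefixUnion A (j + 1)) - G (prefixUnion A j))
    {S : Finset (Fin p)} (hS : S ∈ D) : ∑ k ∈ S, s k = G S := by
  have hpart := hA.existsUnique_mem hD
  rw [sum_eq_sum_inter hpart, eq_sum_sub_prefixUnion hpart h0]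
  refine Finset.sum_congr rfl fun j _ => ?_
  have hAj : IsBlock D (A j) := (hA.isBlock_iff _).2 ⟨j, rfl⟩
  -- A block is either contained in `S` or disjoint from it. In the first case modularity on `S ∩
  -- B_j` and `B_{j-1}` identifies the increment inside `S` with the full increment; in the second
  -- both terms vanish.
  by_cases h : ∃ x ∈ A j, x ∈ S
  · obtain ⟨x, hx, hxS⟩ := h
    have hsub := hAj.subset_of_mem hD hS hx hxS
    have hmod := hG (S ∩ prefixUnion A (j + 1)) (hD.inter_mem _ hS _ (hA.prefixUnion_mem hD _))
      (prefixUnion A j) (hA.prefixUnion_mem hD _)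
    have e1 : S ∩ prefixUnion A (j + 1) ∪ prefixUnion A j = prefixUnion A (j + 1) := by
      rw [prefixUnion_succ]; ext y; have := @hsub y
      simp only [Finset.mem_union, Finset.mem_inter]; tauto
    have e2 : S ∩ prefixUnion A (j + 1) ∩ prefixUnion A j = S ∩ prefixUnion A j := by
      rw [prefixUnion_succ]; ext; simp only [Finset.mem_union, Finset.mem_inter]; tauto
    rw [e1, e2] at hmod
    rw [Finset.inter_eq_right.2 hsub, hs]
    linarith
  · have he : S ∩ A j = ∅ := by
      ext y
      simp only [Finset.mem_inter, Finset.notMem_empty, iff_false]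
      exact fun hy => h ⟨y, hy.2, hy.1⟩
    rw [prefixUnion_succ, Finset.inter_union_distrib_left, he]
    simp

end Lattice

/-! ### Gaussian tails -/

/-- In `(x + t)² = x² + 2tx + t²` the cross term is nonnegative and can be dropped from the
exponent. -/
lemma gaussianPDF_neg_le (v : NNReal) {t x : ℝ} (hx : 0 ≤ t * x) :
    gaussianPDF (-t) v x ≤ ENNReal.ofReal (Real.exp (-(t ^ 2 / (2 * v)))) * gaussianPDF 0 v x := by
  rw [gaussianPDF, gaussianPDF, ← ENNReal.ofReal_mul (Real.exp_nonneg _)]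
  refine ENNReal.ofReal_le_ofReal ?_
  rw [gaussianPDFReal, gaussianPDFReal, mul_left_comm, ← Real.exp_add]
  gcongr
  rw [← neg_div, ← add_div]
  gcongr
  nlinarith

/-- Each tail is translated to a half-line at the origin at the cost of the exponential factor. The
two half-lines together have mass one, so the two-sided bound carries no factor 2; the sum over
block averages in the final estimate needs this. -/
lemma gaussianReal_tail {v : NNReal} (hv : v ≠ 0) {t : ℝ} (ht : 0 ≤ t) :
    gaussianReal 0 v {x | t ≤ |x|} ≤ ENNReal.ofReal (Real.exp (-(t ^ 2 / (2 * v)))) := by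
  set c := ENNReal.ofReal (Real.exp (-(t ^ 2 / (2 * v))))
  have key : ∀ (r : ℝ) (s : Set ℝ), MeasurableSet s → r ^ 2 = t ^ 2 → (∀ x ∈ s, 0 ≤ r * x) →
      gaussianReal 0 v ((fun x => x + -r) ⁻¹' s) ≤ c * gaussianReal 0 v s := by
    intro r s hs hr hrs
    rw [← Measure.map_apply (by fun_prop) hs, gaussianReal_map_add_const, zero_add,
      gaussianReal_apply _ hv, gaussianReal_apply _ hv, ← lintegral_const_mul _ (by fun_prop)]
    refine setLIntegral_mono (by fun_prop) fun x hx => ?_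
    have := gaussianPDF_neg_le v (hrs x hx)
    rwa [hr] at this
  have h1 := key t (Set.Ici 0) measurableSet_Ici rfl fun x hx => mul_nonneg ht hx
  have h2 := key (-t) (Set.Iic 0) measurableSet_Iic (by ring) fun x hx =>
    mul_nonneg_of_nonpos_of_nonpos (by linarith) hx
  have := nullSingletonClass_gaussianReal (μ := 0) hv
  calc gaussianReal 0 v {x | t ≤ |x|}
      ≤ gaussianReal 0 v ((fun x => x + -t) ⁻¹' Set.Ici 0 ∪ (fun x => x + - -t) ⁻¹' Set.Iic 0) := by
        refine measure_mono fun x hx => ?_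
        rcases le_abs'.1 (show t ≤ |x| from hx) with h | h
        · right; simp only [Set.mem_preimage, Set.mem_Iic]; linarith
        · left; simp only [Set.mem_preimage, Set.mem_Ici]; linarith
    _ ≤ c * gaussianReal 0 v (Set.Ici 0) + c * gaussianReal 0 v (Set.Iic 0) :=
        (measure_union_le _ _).trans (add_le_add h1 h2)
    _ = c * (gaussianReal 0 v (Set.Ici 0) + gaussianReal 0 v (Set.Iio 0)) := by
        rw [mul_add, measure_congr (Iio_ae_eq_Iic (μ := gaussianReal 0 v) (a := (0 : ℝ)))]
    _ = c := by
        rw [← measure_union (by simp [Set.disjoint_left]) measurableSet_Iio]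
        simp

/-- Variance zero must be allowed: the centred noise on a singleton block vanishes identically. -/
lemma gaussianReal_tail_of_le {v : NNReal} {b : ℝ} (hvb : v ≤ b) {t : ℝ}
    (ht : 0 ≤ t) :
    (gaussianReal 0 v).real {x | t ≤ |x|} ≤ Real.exp (-(t ^ 2 / (2 * b))) := by
  refine ENNReal.toReal_le_of_le_ofReal (Real.exp_nonneg _) ?_
  rcases ht.eq_or_lt with rfl | ht'
  · simp
  by_cases hv : v = 0
  · simp [hv, ht']
  refine (gaussianReal_tail hv ht).trans (ENNReal.ofReal_le_ofReal ?_)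
  have : 0 < (v : ℝ) := lt_of_le_of_ne v.2 fun h => hv (NNReal.coe_eq_zero.1 h.symm)
  gcongr

/-- Two-sided tail bound for a linear image of a standard Gaussian vector. -/
lemma measureReal_le_abs_sum_le {Ω : Type*} [MeasurableSpace Ω] {P : Measure Ω}
    {ε : Ω → EuclideanSpace ℝ (Fin p)}
    (hε : HasLaw ε (stdGaussian (EuclideanSpace ℝ (Fin p))) P) (a : Fin p → ℝ) {b : ℝ}
    (hab : ∑ k, a k ^ 2 ≤ b) {t : ℝ} (ht : 0 ≤ t) :
    P.real {ω | t ≤ |∑ k, a k * ε ω k|} ≤ Real.exp (-(t ^ 2 / (2 * b))) := by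
  set L : StrongDual ℝ (EuclideanSpace ℝ (Fin p)) :=
    InnerProductSpace.toDual ℝ _ (WithLp.toLp 2 a) with hL
  have hLx : ∀ x, L x = ∑ k, a k * x k := fun x => by
    simp [hL, InnerProductSpace.toDual_apply_apply, PiLp.inner_apply, mul_comm]
  have hnorm : ‖L‖ ^ 2 = ∑ k, a k ^ 2 := by
    rw [hL, LinearIsometryEquiv.norm_map, EuclideanSpace.real_norm_sq_eq]
  have hlaw : (stdGaussian (EuclideanSpace ℝ (Fin p))).map L =
      gaussianReal 0 (‖L‖ ^ 2).toNNReal := by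
    rw [IsGaussian.map_eq_gaussianReal, integral_strongDual_stdGaussian, variance_dual_stdGaussian]
  have hms : MeasurableSet {x : ℝ | t ≤ |x|} := measurableSet_le measurable_const (by fun_prop)
  have hLm : Measurable L := L.continuous.measurable
  simp_rw [← hLx]
  rw [hε.measureReal_eq (p := fun x => t ≤ |L x|) (hLm hms),
    show {x | t ≤ |L x|} = L ⁻¹' {x : ℝ | t ≤ |x|} from rfl,
    ← map_measureReal_apply hLm hms, hlaw]
  refine gaussianReal_tail_of_le ?_ ht
  rw [Real.coe_toNNReal _ (sq_nonneg _), hnorm]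
  exact hab

/-! ### Level set recovery -/

/-- If the noise is small within every block, then `λ (F(B_j) - F(B_{j-1})) / |A_j|` plus the
centred noise is dominated on `A_j` by the increments of `λ F`. -/
lemma sum_noise_add_slope_le {A B : Finset (Fin p)} (hA : A.Nonempty) {F : Finset (Fin p) → ℝ}
    {lam η : ℝ} (hlam : 0 ≤ lam)
    (hmargin : ∀ C ⊆ A, η * min ((C.card : ℝ) / A.card) (1 - (C.card : ℝ) / A.card) ≤
        F (B ∪ C) - F B - (C.card : ℝ) / A.card * (F (B ∪ A) - F B))
    {x : Fin p → ℝ} (hx0 : ∑ k ∈ A, x k = 0) (hx : ∀ k ∈ A, |x k| ≤ lam * η / A.card)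
    {C : Finset (Fin p)} (hC : C ⊆ A) :
    ∑ k ∈ C, (x k + lam * ((F (B ∪ A) - F B) / A.card)) ≤ lam * F (B ∪ C) - lam * F B := by
  have hpos : (0 : ℝ) < A.card := by exact_mod_cast hA.card_pos
  have h1 : ∑ k ∈ C, x k ≤ C.card * (lam * η / A.card) := by
    rw [← nsmul_eq_mul]
    exact Finset.sum_le_card_nsmul _ _ _ fun k hk => (le_abs_self _).trans (hx k (hC hk))
  -- Since `x` sums to zero on `A`, its sum over `C` is minus its sum over `A \ C`. This supplies
  -- the second argument of the minimum.
  have h2 : ∑ k ∈ C, x k ≤ (A.card - C.card) * (lam * η / A.card) := by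
    have hsplit := Finset.sum_sdiff (f := x) hC
    have h3 : ∑ k ∈ A \ C, -x k ≤ (A \ C).card • (lam * η / A.card) :=
      Finset.sum_le_card_nsmul _ _ _ fun k hk =>
        (neg_le_abs _).trans (hx k (Finset.sdiff_subset hk))
    rw [nsmul_eq_mul, Finset.sum_neg_distrib, Finset.card_sdiff_of_subset hC,
      Nat.cast_sub (Finset.card_le_card hC)] at h3
    linarith
  have h3 : ∑ k ∈ C, x k ≤
      lam * (η * min ((C.card : ℝ) / A.card) (1 - (C.card : ℝ) / A.card)) := by
    rcases min_choice ((C.card : ℝ) / A.card) (1 - (C.card : ℝ) / A.card) with h | h <;> rw [h]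
    · exact h1.trans_eq (by ring)
    · exact h2.trans_eq (by field_simp)
  have h4 := mul_le_mul_of_nonneg_left (hmargin C hC) hlam
  rw [Finset.sum_add_distrib, Finset.sum_const, nsmul_eq_mul]
  have : (C.card : ℝ) * (lam * ((F (B ∪ A) - F B) / A.card)) =
      lam * ((C.card : ℝ) / A.card * (F (B ∪ A) - F B)) := by ring
  rw [this]
  linarith

/-- The average of `e` over `S`. -/
noncomputable def mean (e : EuclideanSpace ℝ (Fin p)) (S : Finset (Fin p)) : ℝ :=
  (∑ k ∈ S, e k) / S.card

/-- The deterministic core: `u` below is the block average of the data minus the slope `d`, and its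
residual is shown to be a subgradient. -/
theorem inOpenFace_of_noise_le {m : ℕ} {F : Finset (Fin p) → ℝ} (hF : IsPenalty F)
    {lam sigma : ℝ} (hlam : 0 ≤ lam) {e wstar : EuclideanSpace ℝ (Fin p)}
    {D : Set (Finset (Fin p))} (hD : IsPreAllowed F D)
    {A : Fin m → Finset (Fin p)} (hA : IsTopologicalOrdering D A)
    {vstar : Fin m → ℝ} (hv : ∀ j, ∀ k ∈ A j, wstar k = vstar j) {η : Fin m → ℝ} {ν : ℝ}
    (hmargin : ∀ j, ∀ C ⊆ A j,
      η j * min ((C.card : ℝ) / (A j).card) (1 - (C.card : ℝ) / (A j).card) ≤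
        F (prefixUnion A j ∪ C) - F (prefixUnion A j) - (C.card : ℝ) / (A j).card *
            (F (prefixUnion A j ∪ A j) - F (prefixUnion A j)))
    (hgap : ∀ i j, i ≠ j → BlockGE D (A i) (A j) → ν ≤ vstar i - vstar j)
    (hbias : ∀ j : Fin m,
      lam * |(F (prefixUnion A (j + 1)) - F (prefixUnion A j)) / (A j).card| ≤ ν / 4)
    (hmean : ∀ j, |sigma * mean e (A j)| < ν / 4)
    (hcentred : ∀ j, ∀ k ∈ A j, |sigma * (e k - mean e (A j))| ≤ lam * η j / (A j).card)
    {w : EuclideanSpace ℝ (Fin p)} (hw : IsProxSolution F lam (wstar + sigma • e) w) :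
    InOpenFace D w := by
  have hpart := hA.existsUnique_mem hD.lattice
  have hblock : ∀ j, IsBlock D (A j) := fun j => (hA.isBlock_iff _).2 ⟨j, rfl⟩
  have hpos : ∀ j, (0 : ℝ) < (A j).card := fun j => by exact_mod_cast (hblock j).nonempty.card_pos
  choose b hb hbu using hpart
  have hbj : ∀ j, ∀ k ∈ A j, b k = j := fun j k hk => (hbu k j hk).symm
  let d : Fin m → ℝ := fun j =>
    lam * ((F (prefixUnion A j ∪ A j) - F (prefixUnion A j)) / (A j).card)
  let v : Fin m → ℝ := fun j => vstar j + sigma * mean e (A j) - d j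
  let u : EuclideanSpace ℝ (Fin p) := WithLp.toLp 2 fun k => v (b k)
  have hu : ∀ j, ∀ k ∈ A j, u k = v j := fun j k hk => by simp only [u, hbj j k hk]
  have hface : InOpenFace D u := by
    constructor
    · intro B hB k hk l hl
      obtain ⟨j, rfl⟩ := (hA.isBlock_iff B).1 hB
      rw [hu j k hk, hu j l hl]
    · intro B B' hB hB' hne hge k hk l hl
      obtain ⟨i, rfl⟩ := (hA.isBlock_iff B).1 hB
      obtain ⟨j, rfl⟩ := (hA.isBlock_iff B').1 hB'
      rw [hu i k hk, hu j l hl]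
      have hd : ∀ j, |d j| ≤ ν / 4 := fun j => by
        have := hbias j
        rw [prefixUnion_succ] at this
        rwa [abs_mul, abs_of_nonneg hlam]
      have h1 := hgap i j (fun h => hne (h ▸ rfl)) hge
      have h2 := abs_lt.1 (hmean i)
      have h3 := abs_lt.1 (hmean j)
      have h4 := abs_le.1 (hd i)
      have h5 := abs_le.1 (hd j)
      simp only [v]
      -- The difference of values exceeds `ν - 4 · ν/4 = 0`; strictness comes from the strict bound
      -- on the block averages.
      linarith
  have ht : ∀ j, ∀ k ∈ A j, (wstar + sigma • e) k - u k = sigma * (e k - mean e (A j)) + d j := by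
    intro j k hk
    rw [hu j k hk]
    simp only [PiLp.add_apply, PiLp.smul_apply, smul_eq_mul, v, hv j k hk]
    ring
  have hzero : ∀ j, ∑ k ∈ A j, sigma * (e k - mean e (A j)) = 0 := fun j => by
    have := (hpos j).ne'
    rw [← Finset.mul_sum, Finset.sum_sub_distrib, Finset.sum_const, nsmul_eq_mul, mean]
    field_simp
    simp
  have hle : ∀ C, ∑ k ∈ C, ((wstar + sigma • e) k - u k) ≤ lam * F C := by
    refine sum_le_of_sum_inter_le (G := fun S => lam * F S) (hA.existsUnique_mem hD.lattice)
      (by simp [hF.empty]) (fun X Y => ?_) fun j C hC => ?_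
    · simpa only [mul_add] using mul_le_mul_of_nonneg_left (hF.submodular X Y) hlam
    · rw [Finset.sum_congr rfl fun k hk => ht j k (hC hk)]
      exact sum_noise_add_slope_le (hblock j).nonempty hlam (hmargin j) (hzero j) (hcentred j) hC
  have heq : ∀ S ∈ D, ∑ k ∈ S, ((wstar + sigma • e) k - u k) = lam * F S := by
    intro S hS
    refine sum_eq_of_modular (G := fun S => lam * F S) hD.lattice hA (by simp [hF.empty])
      (fun X hX Y hY => ?_) (fun j => ?_) hS
    · simp only [← mul_add, hD.modular X hX Y hY]
    · have := (hpos j).ne'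
      rw [Finset.sum_congr rfl (ht j), Finset.sum_add_distrib, hzero, Finset.sum_const,
        nsmul_eq_mul, prefixUnion_succ]
      simp only [d]
      field_simp
      ring
  have hsol : IsProxSolution F lam (wstar + sigma • e) u :=
    isProxSolution_of_subgradient hF
      (by rw [heq _ hD.lattice.univ_mem, hF.univ, mul_zero]) hle
      fun α => heq _ (hface.levelSet_mem hD.lattice α)
  rwa [(existsUnique_isProxSolution hF hlam _).unique hw hsol]

/-! ### Tail bounds for block averages and centred coordinates -/

section Probability

variable {Ω : Type*} [MeasurableSpace Ω] {P : Measure Ω} {ε : Ω → EuclideanSpace ℝ (Fin p)}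

lemma measureReal_le_abs_mean_le (hε : HasLaw ε (stdGaussian (EuclideanSpace ℝ (Fin p))) P)
    {S : Finset (Fin p)} (hS : S.Nonempty) (sigma : ℝ) {t : ℝ} (ht : 0 ≤ t) :
    P.real {ω | t ≤ |sigma * mean (ε ω) S|} ≤
      Real.exp (-(t ^ 2 / (2 * (sigma ^ 2 / S.card)))) := by
  have hpos : (0 : ℝ) < S.card := by exact_mod_cast hS.card_pos
  have h := measureReal_le_abs_sum_le hε (fun k => if k ∈ S then sigma / S.card else 0)
    (b := sigma ^ 2 / S.card) (le_of_eq ?_) ht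
  · convert! h using 5 with ω
    simp only [ite_mul, zero_mul, Finset.sum_ite_mem, Finset.univ_inter, mean]
    rw [← Finset.mul_sum]
    ring_nf
  · simp only [ite_pow, ne_eq, OfNat.ofNat_ne_zero, not_false_eq_true, zero_pow,
      Finset.sum_ite_mem, Finset.univ_inter, Finset.sum_const, nsmul_eq_mul]
    field_simp

lemma measureReal_le_abs_sub_mean_le (hε : HasLaw ε (stdGaussian (EuclideanSpace ℝ (Fin p))) P)
    {S : Finset (Fin p)} {k : Fin p} (hk : k ∈ S) (sigma : ℝ) {t : ℝ} (ht : 0 ≤ t) :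
    P.real {ω | t ≤ |sigma * (ε ω k - mean (ε ω) S)|} ≤ Real.exp (-(t ^ 2 / (2 * sigma ^ 2))) := by
  have hpos : (0 : ℝ) < S.card := by exact_mod_cast Finset.card_pos.2 ⟨k, hk⟩
  have h := measureReal_le_abs_sum_le hε
    (fun i => sigma * ((if i = k then 1 else 0) - if i ∈ S then (S.card : ℝ)⁻¹ else 0))
    (b := sigma ^ 2) ?_ ht
  · convert! h using 5 with ω
    simp only [mul_assoc, sub_mul, ite_mul, one_mul, zero_mul, ← Finset.mul_sum,
      Finset.sum_sub_distrib, Finset.sum_ite_eq', Finset.mem_univ, if_true, Finset.sum_ite_mem,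
      Finset.univ_inter, mean]
    ring_nf
  · have hsum : ∑ i : Fin p, ((if i = k then 1 else 0) - if i ∈ S then (S.card : ℝ)⁻¹ else 0) ^ 2
        = 1 - (S.card : ℝ)⁻¹ := by
      have : ∀ i : Fin p, ((if i = k then 1 else 0) - if i ∈ S then (S.card : ℝ)⁻¹ else 0) ^ 2 =
          (if i = k then 1 - 2 * (S.card : ℝ)⁻¹ else 0) +
            if i ∈ S then (S.card : ℝ)⁻¹ ^ 2 else 0 := by
        intro i
        by_cases hi : i = k
        · subst hi
          simp only [if_true, hk]
          ring
        · by_cases hiS : i ∈ S <;> simp [hi, hiS]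
      simp_rw [this]
      rw [Finset.sum_add_distrib]
      simp only [Finset.sum_ite_eq', Finset.mem_univ, if_true, Finset.sum_ite_mem,
        Finset.univ_inter, Finset.sum_const, nsmul_eq_mul]
      field_simp
      ring
    simp_rw [mul_pow]
    rw [← Finset.mul_sum, hsum]
    have : 0 < (S.card : ℝ)⁻¹ := by positivity
    nlinarith [sq_nonneg sigma]

end Probability

end LevelSet

theorem theorem1 {p m : ℕ} {Ω : Type*} [MeasurableSpace Ω] (P : Measure Ω)
    [IsProbabilityMeasure P]
    (F : Finset (Fin p) → ℝ) (hF : LevelSet.IsPenalty F)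
    (lam sigma : ℝ) (hlam : 0 ≤ lam) (hsigma : 0 < sigma)
    (ε : Ω → EuclideanSpace ℝ (Fin p))
    (hε : HasLaw ε (stdGaussian (EuclideanSpace ℝ (Fin p))) P)
    (wstar : EuclideanSpace ℝ (Fin p))
    (D : Set (Finset (Fin p))) (hD : LevelSet.IsAssociated F D wstar)
    (A : Fin m → Finset (Fin p)) (hA : LevelSet.IsTopologicalOrdering D A)
    (vstar : Fin m → ℝ) (hv : ∀ j, ∀ k ∈ A j, wstar k = vstar j)
    (η : Fin m → ℝ) (hη : ∀ j, 0 < η j) (ν : ℝ) (hν : 0 < ν)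
    (hmargin : ∀ j, ∀ C ⊆ A j,
      η j * min ((C.card : ℝ) / (A j).card) (1 - (C.card : ℝ) / (A j).card) ≤
        F (LevelSet.prefixUnion A j ∪ C) - F (LevelSet.prefixUnion A j)
          - (C.card : ℝ) / (A j).card *
            (F (LevelSet.prefixUnion A j ∪ A j) - F (LevelSet.prefixUnion A j)))
    (hgap : ∀ i j, i ≠ j → LevelSet.BlockGE D (A i) (A j) → ν ≤ vstar i - vstar j)
    (hbias : ∀ j : Fin m,
      lam * |(F (LevelSet.prefixUnion A (j + 1)) - F (LevelSet.prefixUnion A j)) / (A j).card|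
        ≤ ν / 4) :
    (∀ z, ∃! w, LevelSet.IsProxSolution F lam z w) ∧
    ∀ what : Ω → EuclideanSpace ℝ (Fin p),
      (∀ ω, LevelSet.IsProxSolution F lam (wstar + sigma • ε ω) (what ω)) →
      1 - ∑ j, Real.exp (-(ν ^ 2 * (A j).card / (32 * sigma ^ 2)))
        - 2 * ∑ j, ((A j).card : ℝ) *
            Real.exp (-(lam ^ 2 * η j ^ 2 / (2 * sigma ^ 2 * ((A j).card : ℝ) ^ 2)))
        ≤ P.real {ω | LevelSet.IsAssociated F D (what ω)} := by
  refine ⟨LevelSet.existsUnique_isProxSolution hF hlam, fun what hwhat => ?_⟩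
  have hne : ∀ j, (A j).Nonempty := fun j =>
    LevelSet.IsBlock.nonempty ((hA.isBlock_iff _).2 ⟨j, rfl⟩)
  let M : Fin m → Set Ω := fun j => {ω | ν / 4 ≤ |sigma * LevelSet.mean (ε ω) (A j)|}
  let N : Fin m → Fin p → Set Ω := fun j k =>
    {ω | lam * η j / (A j).card ≤ |sigma * (ε ω k - LevelSet.mean (ε ω) (A j))|}
  have hM : ∀ j, P.real (M j) ≤ Real.exp (-(ν ^ 2 * (A j).card / (32 * sigma ^ 2))) := fun j => by
    have hpos : (0 : ℝ) < (A j).card := by exact_mod_cast (hne j).card_pos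
    refine (LevelSet.measureReal_le_abs_mean_le hε (hne j) sigma (by positivity)).trans_eq ?_
    congr 2
    field_simp
    norm_num
  have hN : ∀ j, ∀ k ∈ A j, P.real (N j k) ≤
      Real.exp (-(lam ^ 2 * η j ^ 2 / (2 * sigma ^ 2 * ((A j).card : ℝ) ^ 2))) := fun j k hk => by
    have hpos : (0 : ℝ) < (A j).card := by exact_mod_cast (hne j).card_pos
    have := hη j
    refine (LevelSet.measureReal_le_abs_sub_mean_le hε hk sigma (by positivity)).trans_eq ?_
    congr 2
    field_simp
  -- Covering the whole space, instead of taking a complement, needs only subadditivity, so no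
  -- measurability of the success event or of `what` is required.
  have hcover : (Set.univ : Set Ω) ⊆ {ω | LevelSet.IsAssociated F D (what ω)} ∪
      ((⋃ j, M j) ∪ ⋃ j, ⋃ k ∈ A j, N j k) := by
    intro ω _
    by_contra hω
    simp only [Set.mem_union, Set.mem_iUnion, Set.mem_ofPred_eq, not_or, not_exists, M, N,
      not_le] at hω
    obtain ⟨h1, h2, h3⟩ := hω
    exact h1 ⟨hD.1, LevelSet.inOpenFace_of_noise_le hF hlam hD.1.toIsPreAllowed hA hv hmargin hgap
      hbias h2 (fun j k hk => (h3 j k hk).le) (hwhat ω)⟩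
  have h1 : 1 ≤ P.real {ω | LevelSet.IsAssociated F D (what ω)} +
      (∑ j, P.real (M j) + ∑ j, ∑ k ∈ A j, P.real (N j k)) := by
    rw [← probReal_univ (μ := P)]
    refine (measureReal_mono hcover).trans ((measureReal_union_le _ _).trans ?_)
    gcongr
    refine (measureReal_union_le _ _).trans ?_
    gcongr
    · exact measureReal_iUnion_fintype_le _
    · refine (measureReal_iUnion_fintype_le _).trans (Finset.sum_le_sum fun j _ => ?_)
      exact measureReal_biUnion_finset_le _ _
  have h2 : ∑ j, P.real (M j) ≤ _ := Finset.sum_le_sum fun j _ => hM j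
  have h3 : ∑ j, ∑ k ∈ A j, P.real (N j k) ≤ ∑ j, ((A j).card : ℝ) *
      Real.exp (-(lam ^ 2 * η j ^ 2 / (2 * sigma ^ 2 * ((A j).card : ℝ) ^ 2))) := by
    refine Finset.sum_le_sum fun j _ => ?_
    rw [← nsmul_eq_mul]
    exact Finset.sum_le_card_nsmul _ _ _ (hN j)
  -- The union bound yields the second sum only once; its nonnegativity allows the coefficient 2 of
  -- the statement.
  have h4 : 0 ≤ ∑ j, ((A j).card : ℝ) *
      Real.exp (-(lam ^ 2 * η j ^ 2 / (2 * sigma ^ 2 * ((A j).card : ℝ) ^ 2))) :=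
    Finset.sum_nonneg fun j _ => by positivity
  linarith
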